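/- Let $T>0$ and let $v\colon\mathbb{R}\times\mathbb{R}\times\mathbb{R}\to\mathbb{R}$, $(t,x,y)\mapsto v(t,x,y)$, be a $C^\infty$ function that is $T$-periodic in $t$. Suppose there are real numbers $a$, $b$ and $\delta>0$ such that $$v(t,x,y)\le a+b\,|y|^{2-\delta}\qquad\text{for all } t,x\in\mathbb{R} \text{ and all } y\in\mathbb{R}\setminus\{0\}.$$ Suppose also that there are two twice differentiable $T$-periodic functions $x_1,x_2\colon\mathbb{R}\to\mathbb{R}$ such that, for all $t\in\mathbb{R}$, 1. $x_1(t)<x_2(t)$, 2. $\ddot x_1(t)>v(t,x_1(t),\dot x_1(t))$, 3. $\ddot x_2(t)<v(t,x_2(t),\dot x_2(t))$. Then there is a $T$-periodic $C^2$ function $x\colon\mathbb{R}\to\mathbb{R}$ which solves $\ddot x(t)=v(t,x(t),\dot x(t))$ for all $t\in\mathbb{R}$ and satisfies $x_1(t)<x(t)<x_2(t)$ for all $t\in\mathbb{R}$. -/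

import Mathlib

open scoped ContDiff

/-- `x` is a (global, twice continuously differentiable) solution of the scalar second order
equation `x'' = v (t, x, x')` on the whole real line. -/
def IsGlobalSolution (v : ℝ → ℝ → ℝ → ℝ) (x : ℝ → ℝ) : Prop :=
  ContDiff ℝ 2 x ∧ ∀ t : ℝ, deriv (deriv x) t = v t (x t) (deriv x t)

/-!
The growth condition is used through a Nagumo-type estimate: if `x'' < K x'²` wherever `|x'| ≥ 1`,
then `x' exp (-K x)` can only be critical where `|x'| < 1`, and this bounds `x'` in terms of the
range of `x`. The right-hand side may therefore be frozen outside a large box, after which it is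
bounded and Lipschitz.

For such a right-hand side `F` and a large `μ`, the map sending `u` to the periodic solution of
`x'' = F(t, u, x') + μ² (x - u)` is well defined (by contraction in `x'`), and by the maximum
principle it is monotone and maps functions between `x₁` and `x₂` strictly between them. A fixed
point is obtained as the supremum of all equi-Lipschitz `u` lying below their image.
-/

open Set Filter Topology Function
open scoped NNReal

/-! ### Extrema of periodic functions -/

section Periodic

variable {T : ℝ} {f : ℝ → ℝ}

theorem periodic_deriv (hf : Periodic f T) : Periodic (deriv f) T := fun t => by
  rw [← deriv_comp_add_const, funext hf]

theorem exists_forall_abs_le_of_periodic (hT : T ≠ 0) (hf : Periodic f T) (hc : Continuous f) :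
    ∃ C, ∀ t, |f t| ≤ C :=
  let ⟨C, hC⟩ := (hf.isBounded_of_continuous hT hc).exists_norm_le
  ⟨C, forall_mem_range.1 hC⟩

theorem exists_forall_le_of_periodic (hT : T ≠ 0) (hf : Periodic f T) (hc : Continuous f) :
    ∃ t₀, ∀ t, f t ≤ f t₀ := by
  obtain ⟨_, ⟨t₀, rfl⟩, ht₀⟩ :=
    (hf.compact_of_continuous hT hc).exists_isGreatest (range_nonempty f)
  exact ⟨t₀, forall_mem_range.1 ht₀⟩

theorem exists_forall_abs_le_and_deriv_eq_zero_of_periodic (hT : T ≠ 0) (hf : Periodic f T)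
    (hc : Continuous f) : ∃ t₀, (∀ t, |f t| ≤ |f t₀|) ∧ deriv f t₀ = 0 := by
  obtain ⟨a, ha⟩ := exists_forall_le_of_periodic hT hf hc
  obtain ⟨b, hb⟩ := exists_forall_le_of_periodic hT (hf.comp Neg.neg) hc.neg
  replace hb : ∀ t, f b ≤ f t := fun t => neg_le_neg_iff.1 (hb t)
  have hmax : ∀ t, |f t| ≤ max |f b| |f a| := fun t => abs_le_max_abs_abs (hb t) (ha t)
  rcases le_total |f b| |f a| with h | h
  · exact ⟨a, fun t => (hmax t).trans_eq (max_eq_right h),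
      IsLocalMax.deriv_eq_zero (Eventually.of_forall ha)⟩
  · exact ⟨b, fun t => (hmax t).trans_eq (max_eq_left h),
      IsLocalMin.deriv_eq_zero (Eventually.of_forall hb)⟩

theorem deriv_deriv_nonpos_of_isLocalMax {t₀ : ℝ} (hf : ContinuousAt f t₀)
    (hmax : IsLocalMax f t₀) : deriv (deriv f) t₀ ≤ 0 := by
  by_contra! hpos
  have hmin : IsLocalMin f t₀ := isLocalMin_of_deriv_deriv_pos hpos hmax.deriv_eq_zero hf
  have hconst : f =ᶠ[𝓝 t₀] fun _ => f t₀ := by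
    filter_upwards [hmax, hmin] with t using le_antisymm
  have hzero : deriv (deriv f) t₀ = 0 := by simpa using hconst.deriv.deriv_eq
  exact hpos.ne' hzero

end Periodic

/-- Periodic functions that are twice differentiable everywhere; the second derivative need not be
continuous. -/
structure IsPeriodicTwiceDiff (T : ℝ) (x : ℝ → ℝ) : Prop where
  periodic : Periodic x T
  differentiable : Differentiable ℝ x
  differentiable_deriv : Differentiable ℝ (deriv x)

/-- Periodic solutions of `x'' = F (t, x, x')`. -/
structure IsPeriodicSolution (F : ℝ → ℝ → ℝ → ℝ) (T : ℝ) (x : ℝ → ℝ) : Prop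
    extends IsPeriodicTwiceDiff T x where
  deriv_deriv_eq : ∀ t, deriv (deriv x) t = F t (x t) (deriv x t)

/-- Strict lower solutions of the periodic problem for `x'' = F (t, x, x')`. -/
structure IsStrictLowerSolution (F : ℝ → ℝ → ℝ → ℝ) (T : ℝ) (p : ℝ → ℝ) : Prop
    extends IsPeriodicTwiceDiff T p where
  lt_deriv_deriv : ∀ t, F t (p t) (deriv p t) < deriv (deriv p) t

/-- Strict upper solutions of the periodic problem for `x'' = F (t, x, x')`. -/
structure IsStrictUpperSolution (F : ℝ → ℝ → ℝ → ℝ) (T : ℝ) (q : ℝ → ℝ) : Prop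
    extends IsPeriodicTwiceDiff T q where
  deriv_deriv_lt : ∀ t, deriv (deriv q) t < F t (q t) (deriv q t)

namespace IsPeriodicTwiceDiff

variable {T : ℝ} {p q : ℝ → ℝ}

theorem deriv_sub_eq (hp : IsPeriodicTwiceDiff T p) (hq : IsPeriodicTwiceDiff T q) :
    deriv (p - q) = deriv p - deriv q :=
  funext fun t => deriv_sub (hp.differentiable t) (hq.differentiable t)

theorem deriv_deriv_sub_eq (hp : IsPeriodicTwiceDiff T p) (hq : IsPeriodicTwiceDiff T q) :
    deriv (deriv (p - q)) = deriv (deriv p) - deriv (deriv q) := by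
  rw [hp.deriv_sub_eq hq]
  exact funext fun t => deriv_sub (hp.differentiable_deriv t) (hq.differentiable_deriv t)

theorem sub (hp : IsPeriodicTwiceDiff T p) (hq : IsPeriodicTwiceDiff T q) :
    IsPeriodicTwiceDiff T (p - q) where
  periodic := hp.periodic.sub hq.periodic
  differentiable := hp.differentiable.sub hq.differentiable
  differentiable_deriv := by
    rw [hp.deriv_sub_eq hq]
    exact hp.differentiable_deriv.sub hq.differentiable_deriv

theorem exists_forall_abs_le (hT : T ≠ 0) (hp : IsPeriodicTwiceDiff T p) :
    ∃ C, ∀ t, |p t| ≤ C :=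
  exists_forall_abs_le_of_periodic hT hp.periodic hp.differentiable.continuous

theorem exists_forall_abs_deriv_le (hT : T ≠ 0) (hp : IsPeriodicTwiceDiff T p) :
    ∃ C, ∀ t, |deriv p t| ≤ C :=
  exists_forall_abs_le_of_periodic hT (periodic_deriv hp.periodic)
    hp.differentiable_deriv.continuous

theorem exists_forall_sub_le (hT : T ≠ 0) (hp : IsPeriodicTwiceDiff T p)
    (hq : IsPeriodicTwiceDiff T q) :
    ∃ t₀, (∀ t, p t - q t ≤ p t₀ - q t₀) ∧ deriv p t₀ = deriv q t₀ ∧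
      deriv (deriv p) t₀ ≤ deriv (deriv q) t₀ := by
  have hpq := hp.sub hq
  obtain ⟨t₀, ht₀⟩ := exists_forall_le_of_periodic hT hpq.periodic hpq.differentiable.continuous
  have hmax : IsLocalMax (p - q) t₀ := Eventually.of_forall ht₀
  have h₁ : deriv (p - q) t₀ = 0 := hmax.deriv_eq_zero
  have h₂ : deriv (deriv (p - q)) t₀ ≤ 0 :=
    deriv_deriv_nonpos_of_isLocalMax hpq.differentiable.continuous.continuousAt hmax
  rw [hp.deriv_sub_eq hq] at h₁
  rw [hp.deriv_deriv_sub_eq hq] at h₂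
  exact ⟨t₀, ht₀, sub_eq_zero.1 h₁, sub_nonpos.1 h₂⟩

theorem le_of_deriv_deriv_lt (hT : T ≠ 0) (hp : IsPeriodicTwiceDiff T p)
    (hq : IsPeriodicTwiceDiff T q)
    (h : ∀ t, deriv p t = deriv q t → q t < p t → deriv (deriv q) t < deriv (deriv p) t) :
    p ≤ q := by
  obtain ⟨t₀, hmax, h₁, h₂⟩ := hp.exists_forall_sub_le hT hq
  have hle : p t₀ ≤ q t₀ := not_lt.1 fun hlt => (h t₀ h₁ hlt).not_ge h₂
  exact fun t => sub_nonpos.1 ((hmax t).trans (sub_nonpos.2 hle))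

theorem lt_of_deriv_deriv_lt (hT : T ≠ 0) (hp : IsPeriodicTwiceDiff T p)
    (hq : IsPeriodicTwiceDiff T q)
    (h : ∀ t, deriv p t = deriv q t → q t ≤ p t → deriv (deriv q) t < deriv (deriv p) t)
    (t : ℝ) : p t < q t := by
  obtain ⟨t₀, hmax, h₁, h₂⟩ := hp.exists_forall_sub_le hT hq
  have hlt : p t₀ < q t₀ := not_le.1 fun hle => (h t₀ h₁ hle).not_ge h₂
  exact sub_neg.1 ((hmax t).trans_lt (sub_neg.2 hlt))

end IsPeriodicTwiceDiff

theorem IsPeriodicSolution.of_hasDerivAt {F : ℝ → ℝ → ℝ → ℝ} {T : ℝ} {x x' : ℝ → ℝ}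
    (hT : Periodic x T) (hx : ∀ t, HasDerivAt x (x' t) t)
    (hx' : ∀ t, HasDerivAt x' (F t (x t) (x' t)) t) : IsPeriodicSolution F T x := by
  obtain rfl : deriv x = x' := funext fun t => (hx t).deriv
  exact ⟨⟨hT, fun t => (hx t).differentiableAt, fun t => (hx' t).differentiableAt⟩,
    fun t => (hx' t).deriv⟩

theorem IsPeriodicSolution.isGlobalSolution {v : ℝ → ℝ → ℝ → ℝ} {T : ℝ} {x : ℝ → ℝ}
    (hv : Continuous fun p : ℝ × ℝ × ℝ => v p.1 p.2.1 p.2.2) (hx : IsPeriodicSolution v T x) :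
    IsGlobalSolution v x := by
  have hcont : Continuous (deriv (deriv x)) := by
    rw [funext hx.deriv_deriv_eq]
    exact hv.comp (continuous_id.prodMk
      (hx.differentiable.continuous.prodMk hx.differentiable_deriv.continuous))
  refine ⟨?_, hx.deriv_deriv_eq⟩
  rw [← one_add_one_eq_two, contDiff_succ_iff_deriv, contDiff_one_iff_deriv]
  exact ⟨hx.differentiable, by simp, hx.differentiable_deriv, hcont⟩

/-! ### The linear equations `y' = g - μ y` and `x'' = g + μ² x` -/

section Linear

variable {T μ C : ℝ} {g h x y : ℝ → ℝ}

theorem integral_exp_mul_comp_add_left (μ T t : ℝ) (g : ℝ → ℝ) :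
    ∫ s in (0 : ℝ)..T, Real.exp (μ * s) * g (t + s) =
      Real.exp (-μ * t) * ∫ s in t..t + T, Real.exp (μ * s) * g s := by
  have hshift := intervalIntegral.integral_comp_add_left (a := 0) (b := T)
    (fun s => Real.exp (μ * s) * g s) t
  rw [add_zero] at hshift
  rw [← hshift, ← intervalIntegral.integral_const_mul]
  congr 1 with s
  rw [← mul_assoc, ← Real.exp_add]
  ring_nf

theorem exists_periodic_hasDerivAt_sub_mul (hT : T ≠ 0) (hμ : μ ≠ 0) (hg : Continuous g)
    (hgT : Periodic g T) : ∃ y, Periodic y T ∧ ∀ t, HasDerivAt y (g t - μ * y t) t := by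
  set c : ℝ := (Real.exp (μ * T) - 1)⁻¹
  have hc : c * (Real.exp (μ * T) - 1) = 1 := by
    refine inv_mul_cancel₀ ?_
    rw [sub_ne_zero, Ne, Real.exp_eq_one_iff]
    exact mul_ne_zero hμ hT
  set J : ℝ → ℝ := fun t => ∫ s in (0 : ℝ)..t, Real.exp (μ * s) * g s
  have hcont : Continuous fun s => Real.exp (μ * s) * g s := by fun_prop
  have hJ : ∀ t, HasDerivAt J (Real.exp (μ * t) * g t) t := fun t =>
    (hcont.integral_hasStrictDerivAt 0 t).hasDerivAt
  -- this formula for the solution makes its periodicity evident, and `hy` its derivative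
  set y : ℝ → ℝ := fun t => c * ∫ s in (0 : ℝ)..T, Real.exp (μ * s) * g (t + s)
  have hy : y = fun t => c * Real.exp (-μ * t) * (J (t + T) - J t) := by
    funext t
    rw [intervalIntegral.integral_interval_sub_left (hcont.intervalIntegrable _ _)
      (hcont.intervalIntegrable _ _), mul_assoc, ← integral_exp_mul_comp_add_left]
  refine ⟨y, fun t => by simp only [y, add_right_comm t T, hgT _], fun t => ?_⟩
  have hderiv := (((hasDerivAt_id t).const_mul (-μ)).exp.const_mul c).mul
    (((hJ (t + T)).comp_add_const t T).sub (hJ t))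
  rw [hy]
  refine hderiv.congr_deriv ?_
  have hneg : Real.exp (-μ * t) * Real.exp (μ * t) = 1 := by
    rw [← Real.exp_add, neg_mul, neg_add_cancel, Real.exp_zero]
  have hadd : Real.exp (μ * (t + T)) = Real.exp (μ * t) * Real.exp (μ * T) := by
    rw [mul_add, Real.exp_add]
  simp only [hadd, hgT t, id_eq, Pi.sub_apply]
  linear_combination g t * c * (Real.exp (μ * T) - 1) * hneg + g t * hc

theorem abs_mul_le_of_hasDerivAt_sub_mul (hT : T ≠ 0) (hyT : Periodic y T)
    (hy : ∀ t, HasDerivAt y (g t - μ * y t) t) (hg : ∀ t, |g t| ≤ C) (t : ℝ) :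
    |μ| * |y t| ≤ C := by
  have hcont : Continuous y := continuous_iff_continuousAt.2 fun t => (hy t).continuousAt
  obtain ⟨t₀, hmax, hcrit⟩ := exists_forall_abs_le_and_deriv_eq_zero_of_periodic hT hyT hcont
  rw [(hy t₀).deriv, sub_eq_zero] at hcrit
  calc |μ| * |y t| ≤ |μ| * |y t₀| := mul_le_mul_of_nonneg_left (hmax t) (abs_nonneg μ)
    _ = |g t₀| := by rw [hcrit, abs_mul]
    _ ≤ C := hg t₀

theorem exists_isPeriodicSolution_add_sq_mul (hT : T ≠ 0) (hμ : μ ≠ 0) (hg : Continuous g)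
    (hgT : Periodic g T) : ∃ x, IsPeriodicSolution (fun t x _ => g t + μ ^ 2 * x) T x := by
  obtain ⟨y, hyT, hy⟩ := exists_periodic_hasDerivAt_sub_mul hT hμ hg hgT
  have hcont : Continuous y := continuous_iff_continuousAt.2 fun t => (hy t).continuousAt
  obtain ⟨x, hxT, hx⟩ := exists_periodic_hasDerivAt_sub_mul hT (neg_ne_zero.2 hμ) hcont hyT
  refine ⟨x, .of_hasDerivAt hxT hx fun t => ?_⟩
  exact ((hy t).sub ((hx t).const_mul (-μ))).congr_deriv (by ring)

theorem IsPeriodicSolution.abs_deriv_le (hT : T ≠ 0) (hμ : 0 < μ)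
    (hx : IsPeriodicSolution (fun t x _ => g t + μ ^ 2 * x) T x) (hg : ∀ t, |g t| ≤ C) (t : ℝ) :
    |deriv x t| ≤ 2 * C / μ := by
  set y : ℝ → ℝ := fun t => deriv x t - μ * x t
  have hyT : Periodic y T := fun t => by
    simp only [y, hx.periodic t, periodic_deriv hx.periodic t]
  have hy : ∀ t, HasDerivAt y (g t - μ * y t) t := fun t =>
    ((hx.differentiable_deriv t).hasDerivAt.sub
      ((hx.differentiable t).hasDerivAt.const_mul μ)).congr_deriv (by
        rw [hx.deriv_deriv_eq]; ring)
  have hx' : ∀ t, HasDerivAt x (y t - -μ * x t) t := fun t =>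
    (hx.differentiable t).hasDerivAt.congr_deriv (by ring)
  have hyC : ∀ t, |y t| ≤ C / μ := fun t => by
    rw [le_div_iff₀' hμ, ← abs_of_pos hμ]
    exact abs_mul_le_of_hasDerivAt_sub_mul hT hyT hy hg t
  have hxC : |(-μ)| * |x t| ≤ C / μ := abs_mul_le_of_hasDerivAt_sub_mul hT hx.periodic hx' hyC t
  calc |deriv x t| = |y t - -μ * x t| := by rw [(hx' t).deriv]
    _ ≤ |y t| + |(-μ)| * |x t| := (abs_sub _ _).trans_eq (by rw [abs_mul])
    _ ≤ C / μ + C / μ := add_le_add (hyC t) hxC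
    _ = 2 * C / μ := by ring

theorem IsPeriodicSolution.abs_deriv_sub_deriv_le (hT : T ≠ 0) (hμ : 0 < μ)
    (hx : IsPeriodicSolution (fun t x _ => g t + μ ^ 2 * x) T x)
    (hy : IsPeriodicSolution (fun t x _ => h t + μ ^ 2 * x) T y) (hgh : ∀ t, |g t - h t| ≤ C)
    (t : ℝ) : |deriv x t - deriv y t| ≤ 2 * C / μ := by
  have hxy : IsPeriodicSolution (fun t x _ => (g t - h t) + μ ^ 2 * x) T (x - y) := by
    refine ⟨hx.sub hy.toIsPeriodicTwiceDiff, fun t => ?_⟩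
    rw [hx.deriv_deriv_sub_eq hy.toIsPeriodicTwiceDiff, Pi.sub_apply, Pi.sub_apply,
      hx.deriv_deriv_eq, hy.deriv_deriv_eq]
    ring
  have hle := hxy.abs_deriv_le hT hμ hgh t
  rwa [hx.deriv_sub_eq hy.toIsPeriodicTwiceDiff] at hle

end Linear

theorem exists_continuousMap_addCircle {X : Type*} [TopologicalSpace X] {T : ℝ} {f : ℝ → X}
    (hf : Periodic f T) (hc : Continuous f) : ∃ z : C(AddCircle T, X), ∀ t : ℝ, z t = f t :=
  ⟨⟨hf.lift, hc.quotient_lift _⟩, hf.lift_coe⟩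

/-! ### Right-hand sides that are Lipschitz in the velocity -/

theorem exists_isPeriodicSolution_of_lipschitzWith {T μ : ℝ} {L : ℝ≥0} (hT : 0 < T) (hμ : 0 < μ)
    (hLμ : 4 * L ≤ μ) {G : ℝ → ℝ → ℝ} (hG : Continuous fun p : ℝ × ℝ => G p.1 p.2)
    (hGT : Periodic G T) (hGL : ∀ t, LipschitzWith L (G t)) :
    ∃ x, IsPeriodicSolution (fun t x y => G t y + μ ^ 2 * x) T x := by
  have : Fact (0 < T) := ⟨hT⟩
  have hsol : ∀ z : C(AddCircle T, ℝ), ∃ x,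
      IsPeriodicSolution (fun t x _ => G t (z t) + μ ^ 2 * x) T x := fun z =>
    exists_isPeriodicSolution_add_sq_mul hT.ne' hμ.ne'
      (hG.comp (continuous_id.prodMk (z.continuous.comp (AddCircle.continuous_mk' T))))
      fun t => by rw [hGT t, AddCircle.coe_add_period]
  choose X hX using hsol
  choose Φ hΦ using fun z => exists_continuousMap_addCircle (periodic_deriv (hX z).periodic)
    (hX z).differentiable_deriv.continuous
  have hcontract : ContractingWith (1 / 2) Φ := by
    refine ⟨by norm_num, LipschitzWith.of_dist_le_mul fun z w => ?_⟩
    rw [ContinuousMap.dist_le (by positivity)]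
    refine fun s => QuotientAddGroup.induction_on s fun t => ?_
    have hGzw : ∀ t : ℝ, |G t (z t) - G t (w t)| ≤ L * dist z w := fun t =>
      ((hGL t).dist_le_mul _ _).trans (by gcongr; exact ContinuousMap.dist_apply_le_dist _)
    calc dist (Φ z t) (Φ w t) = |deriv (X z) t - deriv (X w) t| := by
          rw [hΦ, hΦ, Real.dist_eq]
      _ ≤ 2 * (L * dist z w) / μ := (hX z).abs_deriv_sub_deriv_le hT.ne' hμ (hX w) hGzw t
      _ ≤ (1 / 2 : ℝ≥0) * dist z w := by
          rw [div_le_iff₀ hμ]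
          push_cast
          linarith [mul_le_mul_of_nonneg_right hLμ (dist_nonneg (x := z) (y := w))]
  obtain ⟨z, hz⟩ : ∃ z, Φ z = z := ⟨_, hcontract.fixedPoint_isFixedPt⟩
  refine ⟨X z, (hX z).toIsPeriodicTwiceDiff, fun t => ?_⟩
  rw [(hX z).deriv_deriv_eq, ← hΦ z t, hz]

/-! ### Fixed points of monotone maps -/

theorem exists_mem_eq_of_monotoneOn {α : Type*} [PartialOrder α] {s : Set α} {f : α → α} {p : α}
    (hs : ∀ c ⊆ s, c.Nonempty → ∃ u ∈ s, IsLUB c u) (hf : MonotoneOn f s) (hmaps : MapsTo f s s)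
    (hp : p ∈ s) (hpf : p ≤ f p) : ∃ u ∈ s, f u = u := by
  obtain ⟨u, hu, hlub⟩ := hs {u ∈ s | u ≤ f u} (sep_subset _ _) ⟨p, hp, hpf⟩
  have hle : u ≤ f u := hlub.2 fun w hw => hw.2.trans (hf hw.1 hu (hlub.1 hw))
  exact ⟨u, hu, (hlub.1 ⟨hmaps hu, hf hu (hmaps hu) hle⟩).antisymm hle⟩

/-- The equi-Lipschitz periodic functions between `p` and `q`, on which the monotone iteration is
carried out. -/
def periodicLipschitzIcc (T : ℝ) (K : ℝ≥0) (p q : ℝ → ℝ) : Set (ℝ → ℝ) :=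
  {u | Periodic u T ∧ LipschitzWith K u ∧ u ∈ Icc p q}

theorem exists_isLUB_of_subset_periodicLipschitzIcc {T : ℝ} {K : ℝ≥0} {p q : ℝ → ℝ}
    {c : Set (ℝ → ℝ)} (hc : c ⊆ periodicLipschitzIcc T K p q) (hne : c.Nonempty) :
    ∃ U ∈ periodicLipschitzIcc T K p q, IsLUB c U := by
  have hlub : IsLUB c (sSup c) := isLUB_csSup hne ⟨q, fun u hu => (hc hu).2.2.2⟩
  have heval : ∀ t, IsLUB (eval t '' c) (sSup c t) := isLUB_pi.1 hlub
  refine ⟨sSup c, ⟨fun t => ?_, LipschitzWith.of_le_add_mul K fun t s => ?_, ?_⟩, hlub⟩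
  · have himage : eval (t + T) '' c = eval t '' c := image_congr fun u hu => (hc hu).1 t
    exact (himage ▸ heval (t + T)).unique (heval t)
  · refine (heval t).2 (forall_mem_image.2 fun u hu => ?_)
    exact ((hc hu).2.1.le_add_mul t s).trans (add_le_add_left (hlub.1 hu s) _)
  · obtain ⟨u, hu⟩ := hne
    exact ⟨(hc hu).2.2.1.trans (hlub.1 hu), hlub.2 fun w hw => (hc hw).2.2.2⟩

/-! ### Existence between lower and upper solutions -/

/-- The right-hand side of the equation `x'' = F (t, u, x') + μ² (x - u)` for the next iterate `x`
of the monotone iteration, in terms of the current iterate `u`. -/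
def iterationField (F : ℝ → ℝ → ℝ → ℝ) (μ : ℝ) (u : ℝ → ℝ) : ℝ → ℝ → ℝ → ℝ :=
  fun t x y => F t (u t) y + μ ^ 2 * (x - u t)

section Iteration

variable {F : ℝ → ℝ → ℝ → ℝ} {T μ : ℝ} {p q u w x z : ℝ → ℝ}

theorem IsPeriodicSolution.of_iterationField_self
    (hx : IsPeriodicSolution (iterationField F μ x) T x) : IsPeriodicSolution F T x :=
  ⟨hx.toIsPeriodicTwiceDiff, fun t => by
    rw [hx.deriv_deriv_eq, iterationField, sub_self, mul_zero, add_zero]⟩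

theorem exists_isPeriodicSolution_iterationField {L : ℝ≥0} (hT : 0 < T) (hμ : 0 < μ)
    (hLμ : 4 * L ≤ μ) (hF : Continuous fun r : ℝ × ℝ × ℝ => F r.1 r.2.1 r.2.2)
    (hFT : Periodic F T) (hFL : ∀ t x, LipschitzWith L (F t x)) (hu : Continuous u)
    (huT : Periodic u T) : ∃ x, IsPeriodicSolution (iterationField F μ u) T x := by
  have hG : Continuous fun r : ℝ × ℝ => F r.1 (u r.1) r.2 - μ ^ 2 * u r.1 :=
    (hF.comp (by fun_prop : Continuous fun r : ℝ × ℝ => (r.1, u r.1, r.2))).sub (by fun_prop)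
  obtain ⟨x, hx⟩ := exists_isPeriodicSolution_of_lipschitzWith
    (G := fun t y => F t (u t) y - μ ^ 2 * u t) hT hμ hLμ hG (fun t => by simp only [hFT t, huT t])
    (fun t => LipschitzWith.of_dist_le_mul fun y z => by
      rw [dist_sub_right]; exact (hFL t (u t)).dist_le_mul y z)
  exact ⟨x, hx.toIsPeriodicTwiceDiff, fun t => by rw [hx.deriv_deriv_eq, iterationField]; ring⟩

theorem IsPeriodicSolution.abs_deriv_le_of_iterationField {M A : ℝ} (hT : T ≠ 0) (hμ : 0 < μ)
    (hFM : ∀ t x y, |F t x y| ≤ M) (huA : ∀ t, |u t| ≤ A)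
    (hx : IsPeriodicSolution (iterationField F μ u) T x) (t : ℝ) :
    |deriv x t| ≤ 2 * (M + μ ^ 2 * A) / μ := by
  have hlin : IsPeriodicSolution
      (fun t z _ => F t (u t) (deriv x t) - μ ^ 2 * u t + μ ^ 2 * z) T x :=
    ⟨hx.toIsPeriodicTwiceDiff, fun t => by rw [hx.deriv_deriv_eq, iterationField]; ring⟩
  refine hlin.abs_deriv_le hT hμ (fun s => (abs_sub _ _).trans ?_) t
  rw [abs_mul, abs_of_nonneg (sq_nonneg μ)]
  gcongr
  exacts [hFM _ _ _, huA s]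

theorem IsPeriodicSolution.le_of_iterationField (hT : T ≠ 0) (hμ : 0 < μ)
    (hF : ∀ t y, Antitone fun x => F t x y - μ ^ 2 * x)
    (hx : IsPeriodicSolution (iterationField F μ u) T x)
    (hz : IsPeriodicSolution (iterationField F μ w) T z) (huw : u ≤ w) : x ≤ z := by
  refine hx.le_of_deriv_deriv_lt hT hz.toIsPeriodicTwiceDiff fun t heq hlt => ?_
  rw [hx.deriv_deriv_eq, hz.deriv_deriv_eq, heq, iterationField, iterationField]
  have hle := hF t (deriv z t) (huw t)
  have hmul := mul_lt_mul_of_pos_left hlt (pow_pos hμ 2)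
  linarith

theorem IsStrictLowerSolution.lt_of_iterationField (hT : T ≠ 0)
    (hF : ∀ t y, Antitone fun x => F t x y - μ ^ 2 * x) (hp : IsStrictLowerSolution F T p)
    (hx : IsPeriodicSolution (iterationField F μ u) T x) (hpu : p ≤ u) (t : ℝ) : p t < x t := by
  refine hp.lt_of_deriv_deriv_lt hT hx.toIsPeriodicTwiceDiff (fun t heq hle => ?_) t
  refine lt_of_le_of_lt ?_ (hp.lt_deriv_deriv t)
  rw [hx.deriv_deriv_eq, ← heq, iterationField]
  have hle' := hF t (deriv p t) (hpu t)
  have hmul := mul_le_mul_of_nonneg_left hle (sq_nonneg μ)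
  linarith

theorem IsStrictUpperSolution.lt_of_iterationField (hT : T ≠ 0)
    (hF : ∀ t y, Antitone fun x => F t x y - μ ^ 2 * x) (hq : IsStrictUpperSolution F T q)
    (hx : IsPeriodicSolution (iterationField F μ u) T x) (huq : u ≤ q) (t : ℝ) : x t < q t := by
  refine hx.lt_of_deriv_deriv_lt hT hq.toIsPeriodicTwiceDiff (fun t heq hle => ?_) t
  refine lt_of_lt_of_le (hq.deriv_deriv_lt t) ?_
  rw [hx.deriv_deriv_eq, heq, iterationField]
  have hle' := hF t (deriv q t) (huq t)
  have hmul := mul_le_mul_of_nonneg_left hle (sq_nonneg μ)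
  linarith

end Iteration

theorem antitone_sub_mul_of_lipschitzWith {L : ℝ≥0} {c : ℝ} {f : ℝ → ℝ} (hf : LipschitzWith L f)
    (hL : L ≤ c) : Antitone fun x => f x - c * x := fun x y hxy => by
  have hle := hf.le_add_mul y x
  rw [Real.dist_eq, abs_of_nonneg (sub_nonneg.2 hxy)] at hle
  linarith [mul_le_mul_of_nonneg_right hL (sub_nonneg.2 hxy)]

theorem antitone_sub_mul_of_lipschitzWith_prod {α : Type*} [PseudoEMetricSpace α] {L : ℝ≥0} {c : ℝ}
    {f : ℝ → α → ℝ} (hf : LipschitzWith L fun r : ℝ × α => f r.1 r.2) (hL : L ≤ c) (y : α) :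
    Antitone fun x => f x y - c * x :=
  antitone_sub_mul_of_lipschitzWith
    ((hf.comp (LipschitzWith.prodMk_right y)).weaken (mul_one L).le) hL

theorem IsPeriodicTwiceDiff.mem_periodicLipschitzIcc {T C : ℝ} {K : ℝ≥0} {p q x : ℝ → ℝ}
    (hx : IsPeriodicTwiceDiff T x) (hC : ∀ t, |deriv x t| ≤ C) (hCK : C ≤ K)
    (hxpq : x ∈ Icc p q) : x ∈ periodicLipschitzIcc T K p q :=
  ⟨hx.periodic, lipschitzWith_of_nnnorm_deriv_le hx.differentiable fun t => (hC t).trans hCK, hxpq⟩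

theorem exists_isPeriodicSolution_between {F : ℝ → ℝ → ℝ → ℝ} {T M : ℝ} {L : ℝ≥0} {p q : ℝ → ℝ}
    (hT : 0 < T) (hF : Continuous fun r : ℝ × ℝ × ℝ => F r.1 r.2.1 r.2.2) (hFT : Periodic F T)
    (hFL : ∀ t, LipschitzWith L fun r : ℝ × ℝ => F t r.1 r.2) (hFM : ∀ t x y, |F t x y| ≤ M)
    (hp : IsStrictLowerSolution F T p) (hq : IsStrictUpperSolution F T q) (hpq : p ≤ q) :
    ∃ x, IsPeriodicSolution F T x ∧ ∀ t, p t < x t ∧ x t < q t := by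
  set μ : ℝ := 4 * L + 1
  have hμ : 0 < μ := by positivity
  have hLy : ∀ t x, LipschitzWith L (F t x) := fun t x =>
    ((hFL t).comp (LipschitzWith.prodMk_left x)).weaken (mul_one L).le
  have hanti : ∀ t y, Antitone fun x => F t x y - μ ^ 2 * x := fun t =>
    antitone_sub_mul_of_lipschitzWith_prod (hFL t) (by nlinarith [L.coe_nonneg])
  obtain ⟨P, hP⟩ := hp.exists_forall_abs_deriv_le hT.ne'
  obtain ⟨A, hA⟩ := hp.exists_forall_abs_le hT.ne'
  obtain ⟨B, hB⟩ := hq.exists_forall_abs_le hT.ne'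
  set N : ℝ := 2 * (M + μ ^ 2 * max A B) / μ
  set K : ℝ≥0 := (max P N).toNNReal
  set S : Set (ℝ → ℝ) := periodicLipschitzIcc T K p q
  have hsol : ∀ u ∈ S, ∃ x, IsPeriodicSolution (iterationField F μ u) T x := fun u hu =>
    exists_isPeriodicSolution_iterationField hT hμ (by simp [μ]) hF hFT hLy hu.2.1.continuous hu.1
  choose! Φ hΦ using hsol
  have hbetween : ∀ u ∈ S, ∀ t, p t < Φ u t ∧ Φ u t < q t := fun u hu t =>
    ⟨hp.lt_of_iterationField hT.ne' hanti (hΦ u hu) hu.2.2.1 t,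
      hq.lt_of_iterationField hT.ne' hanti (hΦ u hu) hu.2.2.2 t⟩
  have hmono : MonotoneOn Φ S := fun u hu w hw =>
    (hΦ u hu).le_of_iterationField hT.ne' hμ hanti (hΦ w hw)
  have hmaps : MapsTo Φ S S := fun u hu => by
    have huAB : ∀ t, |u t| ≤ max A B := fun t =>
      (abs_le_max_abs_abs (hu.2.2.1 t) (hu.2.2.2 t)).trans (max_le_max (hA t) (hB t))
    have hN := (hΦ u hu).abs_deriv_le_of_iterationField hT.ne' hμ hFM huAB
    exact (hΦ u hu).mem_periodicLipschitzIcc hN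
      ((le_max_right P N).trans (Real.le_coe_toNNReal _))
      ⟨fun t => (hbetween u hu t).1.le, fun t => (hbetween u hu t).2.le⟩
  have hpS : p ∈ S := hp.mem_periodicLipschitzIcc hP
    ((le_max_left P N).trans (Real.le_coe_toNNReal _)) ⟨le_rfl, hpq⟩
  obtain ⟨x, hxS, hx⟩ := exists_mem_eq_of_monotoneOn
    (fun _ => exists_isLUB_of_subset_periodicLipschitzIcc) hmono hmaps hpS
    fun t => (hbetween p hpS t).1.le
  have hxsol := hΦ x hxS
  have hxpq := hbetween x hxS
  rw [hx] at hxsol hxpq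
  exact ⟨x, hxsol.of_iterationField_self, hxpq⟩

/-! ### A priori bound on the derivative and truncation -/

theorem IsPeriodicTwiceDiff.abs_deriv_le_exp {T K A B : ℝ} {x : ℝ → ℝ} (hT : T ≠ 0) (hK : 0 ≤ K)
    (hx : IsPeriodicTwiceDiff T x) (hxAB : ∀ t, x t ∈ Icc A B)
    (h : ∀ t, 1 ≤ |deriv x t| → deriv (deriv x) t < K * deriv x t ^ 2) (t : ℝ) :
    |deriv x t| ≤ Real.exp (K * (B - A)) := by
  set E : ℝ → ℝ := fun t => Real.exp (-K * x t)
  have hf : ∀ t, HasDerivAt (fun t => deriv x t * E t)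
      ((deriv (deriv x) t - K * deriv x t ^ 2) * E t) t := fun t =>
    ((hx.differentiable_deriv t).hasDerivAt.mul
      ((hx.differentiable t).hasDerivAt.const_mul (-K)).exp).congr_deriv (by ring)
  have hfT : Periodic (fun t => deriv x t * E t) T := fun t => by
    simp only [E, hx.periodic t, periodic_deriv hx.periodic t]
  obtain ⟨t₀, hmax, hcrit⟩ := exists_forall_abs_le_and_deriv_eq_zero_of_periodic hT hfT
    (continuous_iff_continuousAt.2 fun t => (hf t).continuousAt)
  have hlt : |deriv x t₀| < 1 := by
    rw [(hf t₀).deriv, mul_eq_zero, or_iff_left (Real.exp_ne_zero _), sub_eq_zero] at hcrit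
    exact not_le.1 fun hle => (h t₀ hle).ne hcrit
  have hmax' : |deriv x t| * E t ≤ |deriv x t₀| * E t₀ := by
    simpa only [abs_mul, E, Real.abs_exp] using hmax t
  calc |deriv x t| = |deriv x t| * E t * Real.exp (K * x t) := by
        rw [mul_assoc, ← Real.exp_add, neg_mul, neg_add_cancel, Real.exp_zero, mul_one]
    _ ≤ 1 * E t₀ * Real.exp (K * x t) := by
        gcongr ?_ * _
        exact hmax'.trans (by gcongr)
    _ = Real.exp (K * (x t - x t₀)) := by
        rw [one_mul, ← Real.exp_add]
        ring_nf
    _ ≤ Real.exp (K * (B - A)) := by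
        gcongr
        exacts [(hxAB t).2, (hxAB t₀).1]

/-- The retraction of the real line onto `[-R, R]`, for `0 ≤ R`. -/
def clamp (R y : ℝ) : ℝ := max (-R) (min R y)

section Clamp

variable {R y : ℝ}

theorem lipschitzWith_clamp (R : ℝ) : LipschitzWith 1 (clamp R) :=
  (LipschitzWith.id.const_min R).const_max (-R)

theorem clamp_of_abs_le (h : |y| ≤ R) : clamp R y = y := by
  rw [clamp, min_eq_right (abs_le.1 h).2, max_eq_right (abs_le.1 h).1]

theorem clamp_mem_Icc (hR : 0 ≤ R) (y : ℝ) : clamp R y ∈ Icc (-R) R :=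
  ⟨le_max_left _ _, max_le (neg_le_self hR) (min_le_left _ _)⟩

theorem abs_clamp (hR : 0 ≤ R) (y : ℝ) : |clamp R y| = min R |y| := by
  rcases le_total |y| R with h | h
  · rw [clamp_of_abs_le h, min_eq_right h]
  · rw [min_eq_left h]
    rcases le_abs'.1 h with h | h
    · rw [clamp, min_eq_right (h.trans (neg_le_self hR)), max_eq_left h, abs_neg, abs_of_nonneg hR]
    · rw [clamp, min_eq_left h, max_eq_right (neg_le_self hR), abs_of_nonneg hR]

end Clamp

/-- The right-hand side `v`, frozen outside the box `|x| ≤ R`, `|y| ≤ R`. -/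
def truncate (v : ℝ → ℝ → ℝ → ℝ) (R : ℝ) : ℝ → ℝ → ℝ → ℝ :=
  fun t x y => v t (clamp R x) (clamp R y)

section Truncate

variable {v : ℝ → ℝ → ℝ → ℝ} {R T : ℝ}

theorem truncate_of_abs_le {x y : ℝ} (hx : |x| ≤ R) (hy : |y| ≤ R) (t : ℝ) :
    truncate v R t x y = v t x y := by
  rw [truncate, clamp_of_abs_le hx, clamp_of_abs_le hy]

theorem continuous_truncate (hv : Continuous fun p : ℝ × ℝ × ℝ => v p.1 p.2.1 p.2.2) (R : ℝ) :
    Continuous fun p : ℝ × ℝ × ℝ => truncate v R p.1 p.2.1 p.2.2 := by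
  have hclamp : Continuous (clamp R) := (lipschitzWith_clamp R).continuous
  exact hv.comp (by fun_prop : Continuous fun p : ℝ × ℝ × ℝ => (p.1, clamp R p.2.1, clamp R p.2.2))

theorem exists_forall_abs_truncate_le
    (hv : Continuous fun p : ℝ × ℝ × ℝ => v p.1 p.2.1 p.2.2) (hT : 0 < T) (hvT : Periodic v T)
    (hR : 0 ≤ R) : ∃ M, ∀ t x y, |truncate v R t x y| ≤ M := by
  obtain ⟨M, hM⟩ := (isCompact_Icc.prod (isCompact_Icc.prod isCompact_Icc) : IsCompact
    (Icc 0 T ×ˢ Icc (-R) R ×ˢ Icc (-R) R)).exists_bound_of_continuousOn hv.continuousOn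
  refine ⟨M, fun t x y => ?_⟩
  obtain ⟨s, hs, hst⟩ := hvT.exists_mem_Ico₀ hT t
  rw [truncate, hst]
  exact hM (s, clamp R x, clamp R y)
    ⟨Ico_subset_Icc_self hs, clamp_mem_Icc hR x, clamp_mem_Icc hR y⟩

theorem exists_lipschitzWith_truncate
    (hv : LocallyLipschitz fun p : ℝ × ℝ × ℝ => v p.1 p.2.1 p.2.2) (hT : 0 < T)
    (hvT : Periodic v T) (hR : 0 ≤ R) :
    ∃ L : ℝ≥0, ∀ t, LipschitzWith L fun r : ℝ × ℝ => truncate v R t r.1 r.2 := by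
  obtain ⟨L, hL⟩ := (hv.locallyLipschitzOn (s := Icc 0 T ×ˢ Icc (-R) R ×ˢ Icc (-R) R)
    ).exists_lipschitzOnWith_of_compact (isCompact_Icc.prod (isCompact_Icc.prod isCompact_Icc))
  refine ⟨L, fun t => ?_⟩
  obtain ⟨s, hs, hst⟩ := hvT.exists_mem_Ico₀ hT t
  have hclamp : LipschitzWith 1 fun r : ℝ × ℝ => (s, clamp R r.1, clamp R r.2) :=
    ((LipschitzWith.prodMk_left s).comp (((lipschitzWith_clamp R).comp .prod_fst).prodMk
      ((lipschitzWith_clamp R).comp .prod_snd))).weaken (by simp)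
  have hmaps : ∀ r : ℝ × ℝ, (s, clamp R r.1, clamp R r.2) ∈ Icc 0 T ×ˢ Icc (-R) R ×ˢ Icc (-R) R :=
    fun r => ⟨Ico_subset_Icc_self hs, clamp_mem_Icc hR r.1, clamp_mem_Icc hR r.2⟩
  rw [← lipschitzOnWith_univ]
  simp only [truncate, hst]
  exact (hL.comp (lipschitzOnWith_univ.2 hclamp) fun r _ => hmaps r).weaken (mul_one L).le

theorem truncate_le_mul_sq {K t x y : ℝ} (hK : 0 ≤ K) (hR : 1 ≤ R) (hx : |x| ≤ R)
    (h : ∀ y, 1 ≤ |y| → v t x y ≤ K * y ^ 2) (hy : 1 ≤ |y|) :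
    truncate v R t x y ≤ K * y ^ 2 := by
  have habs : |clamp R y| = min R |y| := abs_clamp (zero_le_one.trans hR) y
  rw [truncate, clamp_of_abs_le hx]
  calc v t x (clamp R y) ≤ K * clamp R y ^ 2 := h _ (habs ▸ le_min hR hy)
    _ ≤ K * y ^ 2 := mul_le_mul_of_nonneg_left (sq_le_sq.2 (habs ▸ min_le_right _ _)) hK

theorem IsStrictLowerSolution.truncate {p : ℝ → ℝ} (hp : IsStrictLowerSolution v T p)
    (hpR : ∀ t, |p t| ≤ R) (hpR' : ∀ t, |deriv p t| ≤ R) :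
    IsStrictLowerSolution (truncate v R) T p :=
  ⟨hp.toIsPeriodicTwiceDiff, fun t => by
    rw [truncate_of_abs_le (hpR t) (hpR' t)]; exact hp.lt_deriv_deriv t⟩

theorem IsStrictUpperSolution.truncate {q : ℝ → ℝ} (hq : IsStrictUpperSolution v T q)
    (hqR : ∀ t, |q t| ≤ R) (hqR' : ∀ t, |deriv q t| ≤ R) :
    IsStrictUpperSolution (truncate v R) T q :=
  ⟨hq.toIsPeriodicTwiceDiff, fun t => by
    rw [truncate_of_abs_le (hqR t) (hqR' t)]; exact hq.deriv_deriv_lt t⟩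

theorem IsPeriodicSolution.of_truncate {x : ℝ → ℝ} (hx : IsPeriodicSolution (truncate v R) T x)
    (hxR : ∀ t, |x t| ≤ R) (hxR' : ∀ t, |deriv x t| ≤ R) : IsPeriodicSolution v T x :=
  ⟨hx.toIsPeriodicTwiceDiff, fun t => by
    rw [hx.deriv_deriv_eq, truncate_of_abs_le (hxR t) (hxR' t)]⟩

theorem IsPeriodicSolution.abs_deriv_le_of_truncate {K A B : ℝ} {x : ℝ → ℝ} (hT : T ≠ 0)
    (hK : 0 ≤ K) (hR : 1 ≤ R) (hx : IsPeriodicSolution (truncate v R) T x)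
    (hxAB : ∀ t, x t ∈ Icc A B) (hxR : ∀ t, |x t| ≤ R)
    (h : ∀ t y, 1 ≤ |y| → v t (x t) y ≤ K * y ^ 2) (t : ℝ) :
    |deriv x t| ≤ Real.exp ((K + 1) * (B - A)) := by
  refine hx.abs_deriv_le_exp hT (by positivity) hxAB (fun t ht => ?_) t
  have hpos : 0 < deriv x t ^ 2 := sq_pos_of_ne_zero (abs_pos.1 (one_pos.trans_le ht))
  calc deriv (deriv x) t = truncate v R t (x t) (deriv x t) := hx.deriv_deriv_eq t
    _ ≤ K * deriv x t ^ 2 := truncate_le_mul_sq hK hR (hxR t) (h t) ht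
    _ < (K + 1) * deriv x t ^ 2 := mul_lt_mul_of_pos_right (lt_add_one K) hpos

end Truncate

theorem exists_isPeriodicSolution_truncate {v : ℝ → ℝ → ℝ → ℝ} {T R : ℝ} {x₁ x₂ : ℝ → ℝ}
    (hv : LocallyLipschitz fun p : ℝ × ℝ × ℝ => v p.1 p.2.1 p.2.2) (hT : 0 < T)
    (hvT : Periodic v T) (hR : 0 ≤ R) (h₁ : IsStrictLowerSolution (truncate v R) T x₁)
    (h₂ : IsStrictUpperSolution (truncate v R) T x₂) (hle : x₁ ≤ x₂) :
    ∃ x, IsPeriodicSolution (truncate v R) T x ∧ ∀ t, x₁ t < x t ∧ x t < x₂ t := by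
  obtain ⟨L, hL⟩ := exists_lipschitzWith_truncate hv hT hvT hR
  obtain ⟨M, hM⟩ := exists_forall_abs_truncate_le hv.continuous hT hvT hR
  have hperiodic : Periodic (truncate v R) T := fun t =>
    funext₂ fun x y => congrFun₂ (hvT t) (clamp R x) (clamp R y)
  exact exists_isPeriodicSolution_between hT (continuous_truncate hv.continuous R) hperiodic hL hM
    h₁ h₂ hle

theorem theorem3p2_general {v : ℝ → ℝ → ℝ → ℝ} {T K : ℝ} {x₁ x₂ : ℝ → ℝ}
    (hv : LocallyLipschitz fun p : ℝ × ℝ × ℝ => v p.1 p.2.1 p.2.2) (hT : 0 < T)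
    (hvT : Periodic v T) (h₁ : IsStrictLowerSolution v T x₁) (h₂ : IsStrictUpperSolution v T x₂)
    (hle : x₁ ≤ x₂) (hK : ∀ t, ∀ x ∈ Icc (x₁ t) (x₂ t), ∀ y, 1 ≤ |y| → v t x y ≤ K * y ^ 2) :
    ∃ x, IsGlobalSolution v x ∧ Periodic x T ∧ ∀ t, x₁ t < x t ∧ x t < x₂ t := by
  obtain ⟨A, hA⟩ := h₁.exists_forall_abs_le hT.ne'
  obtain ⟨B, hB⟩ := h₂.exists_forall_abs_le hT.ne'
  obtain ⟨P, hP⟩ := h₁.exists_forall_abs_deriv_le hT.ne'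
  obtain ⟨Q, hQ⟩ := h₂.exists_forall_abs_deriv_le hT.ne'
  obtain ⟨R, hR, hAR, hBR, hPR, hQR, hER⟩ : ∃ R, 1 ≤ R ∧ A ≤ R ∧ B ≤ R ∧ P ≤ R ∧ Q ≤ R ∧
      Real.exp ((|K| + 1) * (B - -A)) ≤ R := by
    simpa only [eventually_and] using ((eventually_ge_atTop 1).and <| (eventually_ge_atTop A).and <|
      (eventually_ge_atTop B).and <| (eventually_ge_atTop P).and <| (eventually_ge_atTop Q).and <|
      eventually_ge_atTop (Real.exp ((|K| + 1) * (B - -A)))).exists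
  obtain ⟨x, hx, hbetween⟩ := exists_isPeriodicSolution_truncate hv hT hvT (zero_le_one.trans hR)
    (h₁.truncate (fun t => (hA t).trans hAR) fun t => (hP t).trans hPR)
    (h₂.truncate (fun t => (hB t).trans hBR) fun t => (hQ t).trans hQR) hle
  have hxAB : ∀ t, x t ∈ Icc (-A) B := fun t =>
    ⟨(abs_le.1 (hA t)).1.trans (hbetween t).1.le, (hbetween t).2.le.trans (abs_le.1 (hB t)).2⟩
  have hxR : ∀ t, |x t| ≤ R := fun t =>
    abs_le.2 ⟨(neg_le_neg hAR).trans (hxAB t).1, (hxAB t).2.trans hBR⟩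
  have hgrowth : ∀ t y, 1 ≤ |y| → v t (x t) y ≤ |K| * y ^ 2 := fun t y hy =>
    (hK t _ (Ioo_subset_Icc_self (hbetween t)) y hy).trans
      (mul_le_mul_of_nonneg_right (le_abs_self K) (sq_nonneg y))
  have hxR' : ∀ t, |deriv x t| ≤ R := fun t =>
    (hx.abs_deriv_le_of_truncate hT.ne' (abs_nonneg K) hR hxAB hxR hgrowth t).trans hER
  exact ⟨x, (hx.of_truncate hxR hxR').isGlobalSolution hv.continuous, hx.periodic, hbetween⟩

theorem add_mul_rpow_le_mul_sq {a b δ y : ℝ} (hδ : 0 ≤ δ) (hy : 1 ≤ |y|) :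
    a + b * |y| ^ (2 - δ) ≤ (|a| + |b|) * y ^ 2 := by
  have hpow : |y| ^ (2 - δ) ≤ y ^ 2 := by
    rw [← sq_abs, ← Real.rpow_two]
    exact Real.rpow_le_rpow_of_exponent_le hy (sub_le_self 2 hδ)
  have hsq : 1 ≤ y ^ 2 := (one_le_sq_iff_one_le_abs y).2 hy
  calc a + b * |y| ^ (2 - δ) ≤ |a| * 1 + |b| * |y| ^ (2 - δ) := by
        rw [mul_one]
        gcongr <;> exact le_abs_self _
    _ ≤ |a| * y ^ 2 + |b| * y ^ 2 := by gcongr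
    _ = (|a| + |b|) * y ^ 2 := by ring

theorem theorem3p2
    (v : ℝ → ℝ → ℝ → ℝ)
    (hv : ContDiff ℝ ∞ (fun p : ℝ × ℝ × ℝ => v p.1 p.2.1 p.2.2))
    (T : ℝ) (hT : 0 < T)
    (hvT : ∀ t x y : ℝ, v (t + T) x y = v t x y)
    (x₁ x₂ : ℝ → ℝ)
    (hx₁ : Differentiable ℝ x₁) (hx₁' : Differentiable ℝ (deriv x₁))
    (hx₂ : Differentiable ℝ x₂) (hx₂' : Differentiable ℝ (deriv x₂))
    (hx₁T : Function.Periodic x₁ T) (hx₂T : Function.Periodic x₂ T)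
    (hlt : ∀ t : ℝ, x₁ t < x₂ t)
    (hlower : ∀ t : ℝ, deriv (deriv x₁) t > v t (x₁ t) (deriv x₁ t))
    (hupper : ∀ t : ℝ, deriv (deriv x₂) t < v t (x₂ t) (deriv x₂ t))
    (a b δ : ℝ) (hδ : 0 < δ)
    (hgrowth : ∀ t x y : ℝ, y ≠ 0 → v t x y ≤ a + b * |y| ^ (2 - δ)) :
    ∃ x : ℝ → ℝ, IsGlobalSolution v x ∧ Function.Periodic x T ∧
      ∀ t : ℝ, x₁ t < x t ∧ x t < x₂ t :=
  theorem3p2_general (hv.of_le (by exact_mod_cast le_top)).locallyLipschitz hT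
    (fun t => funext₂ (hvT t)) ⟨⟨hx₁T, hx₁, hx₁'⟩, hlower⟩ ⟨⟨hx₂T, hx₂, hx₂'⟩, hupper⟩
    (fun t => (hlt t).le) fun t x _ y hy =>
      (hgrowth t x y (abs_pos.1 (one_pos.trans_le hy))).trans (add_mul_rpow_le_mul_sq hδ.le hy)
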